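/- Let $F$ be a totally real number field with ring of integers $\mathcal O_F$, let $a,b\in\mathcal O_F$ be nonzero, and let $D=(a,b)_F$ be the quaternion algebra with basis $1,i,j,k$, $i^2=a$, $j^2=b$, $k=ij=-ji$, and reduced norm $N(x_0+x_1i+x_2j+x_3k)=x_0^2-ax_1^2-bx_2^2+abx_3^2$. Let $\sigma_1,\dots,\sigma_r\colon F\hookrightarrow\mathbb R$ ($r\ge 1$) be the distinct real embeddings at which $D$ is split (that is, $D\otimes_{F,\sigma}\mathbb R\cong M_2(\mathbb R)$), $D$ being ramified at all other real embeddings, and suppose $\sigma_1(a),\dots,\sigma_r(a)>0$. View $F$ as a subfield of $\mathbb R$ via $\sigma_1$. Fix isomorphisms of $\mathbb R$-algebras $\tau_k\colon D\otimes_{F,\sigma_k}\mathbb R\to M_2(\mathbb R)$ for $k=1,\dots,r$, where $\tau_1$ is given by $$\tau_1(x+yi+zj+wk)=\begin{pmatrix}x+y\sqrt a & z+w\sqrt a\\ b(z-w\sqrt a)& x-y\sqrt a\end{pmatrix}.$$ The group $D^\times$ acts on $(\mathbb H^2)^r$ through $(\tau_1,\dots,\tau_r)$, where $\mathrm{GL}_2(\mathbb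 R)$ acts on the upper half plane $\mathbb H^2$ by fractional linear transformations, composed with complex conjugation if the determinant is negative. Let $\Lambda=\mathcal O_F\oplus\mathcal O_Fi\oplus\mathcal O_Fj\oplus\mathcal O_Fk\subset D$, and for a commutative $\mathcal O_F$-algebra $R$ let $\mathrm{SL}_\Lambda(R)$ be the group of elements of reduced norm one in $R\otimes_{\mathcal O_F}\Lambda$; so $\Lambda^1:=\mathrm{SL}_\Lambda(\mathcal O_F)$ is the group of elements of reduced norm one in $\Lambda$. Let $\widehat{\mathcal O}_F=\prod_v\mathcal O_v$ be the ring of integral finite adeles of $F$, and give $\mathrm{SL}_\Lambda(\widehat{\mathcal O}_F)\subset\widehat{\mathcal O}_F^{\,4}$ the subspace topology. Write $C_G(g)=\{h\in G: gh=hg\}$, also when $g\notin G$. Let $\alpha\in D^\times$ with $N(\alpha)=1$ and $\beta\in D^\times$ be such that for each $k$ the matrices $\tau_k(\alpha)$ and $\tau_k(\beta)$ each have two distinct real eigenvalues, and such that $\tau_1(\beta)$ is diagonalizable over $F(\sqrt a)$. Then for every $\gamma\in\Lambda^1$ that lies in the closure of $C_{\Lambda^1}(\beta)\,C_{\Lambda^1}(\alpha)$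 in $\mathrm{SL}_\Lambda(\widehat{\mathcal O}_F)$, there exist $x\in C_{D^\times}(\beta)$ and $y\in C_{D^\times}(\alpha)$ such that $\gamma=xy$ and such that $x$ acts by an orientation-preserving isometry on $(\mathbb H^2)^r$, and moreover by an orientation-preserving map on each factor $\mathbb H^2$, that is, $\det\tau_k(x)>0$ for all $k$. -/

import Mathlib

open scoped Topology

noncomputable section

namespace QuatProd

/-- The quaternion algebra `(a, b)_R`: the free `R`-module on `1, i, j, k` with
`i² = a`, `j² = b`, `k = ij = -ji`. -/
abbrev Quat {R : Type*} [CommRing R] (a b : R) : Type _ := QuaternionAlgebra R a 0 b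

/-- The reduced norm `x₀² - a x₁² - b x₂² + a b x₃²`, a multiplicative map `(a, b)_R → R`. -/
def nrd {R : Type*} [CommRing R] (a b : R) : Quat a b →* R where
  toFun x := x.re ^ 2 - a * x.imI ^ 2 - b * x.imJ ^ 2 + a * b * x.imK ^ 2
  map_one' := by simp
  map_mul' x y := by
    simp only [QuaternionAlgebra.re_mul, QuaternionAlgebra.imI_mul, QuaternionAlgebra.imJ_mul,
      QuaternionAlgebra.imK_mul]
    ring

/-- Functoriality of `(a, b)_R` in the coefficient ring: `f` is applied to all coordinates. -/
def Quat.map {R S : Type*} [CommRing R] [CommRing S] (f : R →+* S) (a b : R) :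
    Quat a b →+* Quat (f a) (f b) where
  toFun x := ⟨f x.re, f x.imI, f x.imJ, f x.imK⟩
  map_one' := by ext <;> simp
  map_zero' := by ext <;> simp
  map_mul' x y := by ext <;> simp
  map_add' x y := by ext <;> simp

theorem nrd_map {R S : Type*} [CommRing R] [CommRing S] (f : R →+* S) (a b : R) (x : Quat a b) :
    nrd (f a) (f b) (Quat.map f a b x) = f (nrd a b x) := by
  simp [nrd, Quat.map]

/-- The group of units of reduced norm one in `(a, b)_R`. For `a, b ∈ 𝓞 F` and
`Λ = 𝓞 F ⊕ 𝓞 F i ⊕ 𝓞 F j ⊕ 𝓞 F k`, one has `A ⊗ Λ = (a, b)_A` for each commutative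
`𝓞 F`-algebra `A`, so this is the group of `A`-points of the group scheme `SL_Λ`.
For `A = 𝓞 F` it is `Λ¹`. -/
def SL {R : Type*} [CommRing R] (a b : R) : Subgroup (Quat a b)ˣ := (Units.map (nrd a b)).ker

/-- Functoriality of `SL` in the coefficient ring. -/
def SL.map {R S : Type*} [CommRing R] [CommRing S] (f : R →+* S) (a b : R) :
    SL a b →* SL (f a) (f b) :=
  ((Units.map (Quat.map f a b : Quat a b →* Quat (f a) (f b))).comp (SL a b).subtype).codRestrict
    (SL (f a) (f b)) fun g => by
      have h : nrd a b ((g : (Quat a b)ˣ) : Quat a b) = 1 := congrArg Units.val g.2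
      refine Units.ext ?_
      change nrd (f a) (f b) (Quat.map f a b ((g : (Quat a b)ˣ) : Quat a b)) = 1
      rw [nrd_map, h, map_one]

/-- The topology on the points of `SL` over a topological ring `R`, induced by the closed embedding
`SL ⊆ R⁴` given by the four coordinates. -/
@[reducible] def SL.topology {R : Type*} [CommRing R] [TopologicalSpace R] (a b : R) :
    TopologicalSpace (SL a b) :=
  TopologicalSpace.induced
    (fun g : SL a b =>
      (((g : (Quat a b)ˣ) : Quat a b).re, ((g : (Quat a b)ˣ) : Quat a b).imI,
        ((g : (Quat a b)ˣ) : Quat a b).imJ, ((g : (Quat a b)ˣ) : Quat a b).imK))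
    inferInstance

section NumberField

variable (F : Type*) [Field F] [NumberField F]

/-- The ring of integral finite adeles `∏_v 𝓞_v` of `F`, with the product topology. -/
abbrev IntegralFiniteAdeles : Type _ :=
  ∀ v : IsDedekindDomain.HeightOneSpectrum (NumberField.RingOfIntegers F),
    v.adicCompletionIntegers F

variable {F}

/-- The quaternion algebra `D = (a, b)_F` for `a, b ∈ 𝓞 F`. -/
abbrev DAlg (a b : NumberField.RingOfIntegers F) : Type _ :=
  Quat (algebraMap (NumberField.RingOfIntegers F) F a)
    (algebraMap (NumberField.RingOfIntegers F) F b)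

/-- The scalar extension `D ⊗_{F,σ} ℝ = (σ(a), σ(b))_ℝ` along a real embedding `σ`. -/
abbrev DReal (a b : NumberField.RingOfIntegers F) (σ : F →+* ℝ) : Type _ :=
  Quat (σ (algebraMap (NumberField.RingOfIntegers F) F a))
    (σ (algebraMap (NumberField.RingOfIntegers F) F b))

/-- `D` is split at the real embedding `σ`. -/
def IsSplitAt (a b : NumberField.RingOfIntegers F) (σ : F →+* ℝ) : Prop :=
  Nonempty (DReal a b σ ≃ₐ[ℝ] Matrix (Fin 2) (Fin 2) ℝ)

/-- The inclusion `Λ¹ → Dˣ`. -/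
def toD (a b : NumberField.RingOfIntegers F) : SL a b →* (DAlg a b)ˣ :=
  (SL _ _).subtype.comp (SL.map (algebraMap (NumberField.RingOfIntegers F) F) a b)

/-- The diagonal map from `Λ¹` to the group of points of `SL_Λ` over the integral finite adeles. -/
def toHat (a b : NumberField.RingOfIntegers F) :
    SL a b →* SL (algebraMap (NumberField.RingOfIntegers F) (IntegralFiniteAdeles F) a)
      (algebraMap (NumberField.RingOfIntegers F) (IntegralFiniteAdeles F) b) :=
  SL.map (algebraMap (NumberField.RingOfIntegers F) (IntegralFiniteAdeles F)) a b

/-- The centralizer in `Λ¹` of an element `g` of `Dˣ` (which need not lie in `Λ¹`). -/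
def centralizerInLambda (a b : NumberField.RingOfIntegers F) (g : (DAlg a b)ˣ) :
    Subgroup (SL a b) :=
  (Subgroup.centralizer {g}).comap (toD a b)

/-- The homomorphism `Dˣ → GL₂(ℝ)` induced by an isomorphism
`τ : D ⊗_{F,σ} ℝ ≅ M₂(ℝ)`. -/
def toGL {a b : NumberField.RingOfIntegers F} {σ : F →+* ℝ}
    (τ : DReal a b σ ≃ₐ[ℝ] Matrix (Fin 2) (Fin 2) ℝ) : (DAlg a b)ˣ →* GL (Fin 2) ℝ :=
  Units.map (((τ : DReal a b σ →+* Matrix (Fin 2) (Fin 2) ℝ).comp (Quat.map σ _ _) :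
    DAlg a b →+* Matrix (Fin 2) (Fin 2) ℝ) : DAlg a b →* Matrix (Fin 2) (Fin 2) ℝ)

/-- The action of `Dˣ` on `(ℍ²)^r` through `τ₁, …, τ_r`. Here `GL₂(ℝ)` acts on the upper half
plane by fractional linear transformations, composed with complex conjugation when the
determinant is negative. -/
def act {r : ℕ} {a b : NumberField.RingOfIntegers F} {σ : Fin r → F →+* ℝ}
    (τ : ∀ k, DReal a b (σ k) ≃ₐ[ℝ] Matrix (Fin 2) (Fin 2) ℝ) (x : (DAlg a b)ˣ)
    (z : Fin r → UpperHalfPlane) : Fin r → UpperHalfPlane :=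
  fun k => toGL (τ k) x • z k

end NumberField

/-- A real `2 × 2` matrix with two distinct real eigenvalues. -/
def HasTwoRealEigenvalues (M : Matrix (Fin 2) (Fin 2) ℝ) : Prop :=
  ∃ s t : ℝ, s ≠ t ∧ Module.End.HasEigenvalue (Matrix.toLin' M) s ∧
    Module.End.HasEigenvalue (Matrix.toLin' M) t

/-- `M` is diagonalizable over the subfield `E` of `ℝ`. -/
def IsDiagonalizableOver (E : Subfield ℝ) (M : Matrix (Fin 2) (Fin 2) ℝ) : Prop :=
  ∃ (P : GL (Fin 2) E) (d : Fin 2 → E),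
    M * (P : Matrix (Fin 2) (Fin 2) E).map E.subtype =
      (P : Matrix (Fin 2) (Fin 2) E).map E.subtype * Matrix.diagonal (fun i => (d i : ℝ))

/-- `f` is an orientation-preserving isometry of `(ℍ²)^r`: it is an isometry for the
Riemannian product metric (the `ℓ²`-product of the hyperbolic distances), and it is differentiable
with differential of positive determinant at each point, where `(ℍ²)^r` is seen as an open
subset of the real vector space `ℂ^r`. -/
def IsOrientationPreservingIsometry {r : ℕ}
    (f : (Fin r → UpperHalfPlane) → (Fin r → UpperHalfPlane)) : Prop :=
  Isometry (fun z : PiLp 2 (fun _ : Fin r => UpperHalfPlane) =>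
    (WithLp.toLp 2 (f (WithLp.ofLp z)) : PiLp 2 (fun _ : Fin r => UpperHalfPlane))) ∧
  ∀ z : Fin r → UpperHalfPlane, ∃ L : (Fin r → ℂ) →L[ℝ] (Fin r → ℂ),
    HasFDerivAt
      (fun w : Fin r → ℂ => fun k => (f (fun l => UpperHalfPlane.ofComplex (w l)) k : ℂ))
      L (fun k => (z k : ℂ)) ∧
    0 < L.det

end QuatProd

end

/-! The closure hypothesis is used one finite place `v` at a time. Over the compact ring of local
integers, the products of norm-one elements commuting with `β` and with `α` form a compact, hence
closed, set, so `γ = p * q` over the completion `F_v` with `p`, `q` of reduced norm one in the two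
centralizers (`exists_local_factorization`).

The conditions "`x` commutes with `β`" and "`γ⁻¹ * x` commutes with `α`" are linear over `F`. Unless
`γ` commutes with `α`, a trivial case, their solutions form a space of dimension at most one, and
this persists over `F_v` (`exists_generator_of_commute`). So one global `x` satisfies `p = c • x` at
every `v`, and norms give `1 = c² nrd x`: the element `nrd x` of `F` is a square at all finite
places. Then `nrd x = t²` in `F`, and `t⁻¹ • x` is a global factor of reduced norm one, so its image
under each `τ k` has positive determinant.

The local-global principle for squares comes from counting ideals. If `d` were a nonsquare that is a
square at every place, each prime of `F` would carry two degree-one primes of `F(√d)`, so pairs of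
ideals of `F` would inject into ideals of `F(√d)` without increasing norms. Linear growth of both
ideal counts forbids this (`false_of_two_families_of_primes`). -/

namespace QuatProd

open IsDedekindDomain NumberField Ideal Filter nonZeroDivisors

/-! ### Counting ideals of bounded norm -/

section IdealCount

variable (K : Type*) [Field K] [NumberField K]

/-- The norm of the ideal `∏ p ∈ m, p`, for a multiset `m` of primes. -/
noncomputable def multisetNorm (m : Multiset (HeightOneSpectrum (𝓞 K))) : ℕ :=
  (m.map fun v => absNorm v.asIdeal).prod

variable {K}

theorem multisetNorm_add (m n : Multiset (HeightOneSpectrum (𝓞 K))) :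
    multisetNorm K (m + n) = multisetNorm K m * multisetNorm K n := by
  simp [multisetNorm]

theorem multisetNorm_pos (m : Multiset (HeightOneSpectrum (𝓞 K))) : 0 < multisetNorm K m := by
  refine Nat.pos_of_ne_zero fun h => ?_
  rw [multisetNorm, Multiset.prod_eq_zero_iff, Multiset.mem_map] at h
  obtain ⟨v, -, hv⟩ := h
  exact v.ne_bot (absNorm_eq_zero_iff.1 hv)

theorem multisetNorm_map_le {L : Type*} [Field L] [NumberField L]
    (P : HeightOneSpectrum (𝓞 K) → HeightOneSpectrum (𝓞 L))
    (hP : ∀ v, absNorm (P v).asIdeal ≤ absNorm v.asIdeal)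
    (m : Multiset (HeightOneSpectrum (𝓞 K))) :
    multisetNorm L (m.map P) ≤ multisetNorm K m := by
  rw [multisetNorm, multisetNorm, Multiset.map_map]
  exact Multiset.prod_map_le_prod_map _ _ fun v _ => hP v

theorem prod_asIdeal_ne_zero {R : Type*} [CommRing R] [IsDedekindDomain R]
    (m : Multiset (HeightOneSpectrum R)) :
    (m.map HeightOneSpectrum.asIdeal).prod ≠ 0 := by
  intro h
  rw [Multiset.prod_eq_zero_iff, Multiset.mem_map] at h
  obtain ⟨v, -, hv⟩ := h
  exact v.ne_bot hv

variable (K) in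
/-- Unique factorization of nonzero ideals, as an equivalence with multisets of primes. -/
noncomputable def multisetEquivIdeal :
    Multiset (HeightOneSpectrum (𝓞 K)) ≃ (Ideal (𝓞 K))⁰ :=
  Equiv.ofBijective (fun m => ⟨(m.map HeightOneSpectrum.asIdeal).prod,
      mem_nonZeroDivisors_of_ne_zero (prod_asIdeal_ne_zero m)⟩) <| by
    classical
    constructor
    · intro m n h
      have h' := congrArg (fun I : (Ideal (𝓞 K))⁰ =>
        UniqueFactorizationMonoid.normalizedFactors (I : Ideal (𝓞 K))) h
      have key (l : Multiset (HeightOneSpectrum (𝓞 K))) :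
          UniqueFactorizationMonoid.normalizedFactors (l.map HeightOneSpectrum.asIdeal).prod =
            l.map HeightOneSpectrum.asIdeal :=
        UniqueFactorizationMonoid.normalizedFactors_prod_of_prime fun p hp => by
          obtain ⟨v, -, rfl⟩ := Multiset.mem_map.1 hp
          exact v.prime
      simp only [key] at h'
      exact Multiset.map_injective (fun v w hvw => HeightOneSpectrum.ext hvw) h'
    · rintro ⟨I, hI⟩
      have hI0 : I ≠ 0 := nonZeroDivisors.ne_zero hI
      have hpr : ∀ p ∈ UniqueFactorizationMonoid.normalizedFactors I, Prime p :=
        fun p hp => UniqueFactorizationMonoid.prime_of_normalized_factor p hp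
      refine ⟨(UniqueFactorizationMonoid.normalizedFactors I).pmap
        (fun p (hp : Prime p) => ⟨p, Ideal.isPrime_of_prime hp, hp.ne_zero⟩) hpr, ?_⟩
      refine Subtype.ext ?_
      simp only [Multiset.map_pmap, Multiset.pmap_eq_map, Multiset.map_id']
      exact (UniqueFactorizationMonoid.prod_normalizedFactors_eq hI0).trans (normalize_eq I)

theorem absNorm_multisetEquivIdeal (m : Multiset (HeightOneSpectrum (𝓞 K))) :
    absNorm (multisetEquivIdeal K m : Ideal (𝓞 K)) = multisetNorm K m := by
  change absNorm (m.map HeightOneSpectrum.asIdeal).prod = _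
  rw [map_multiset_prod, Multiset.map_map]
  rfl

/-- The limit is the residue of the Dedekind zeta function at 1; only its positivity matters later.
-/
theorem exists_tendsto_card_multisetNorm_le (K : Type*) [Field K] [NumberField K] :
    ∃ κ : ℝ, 0 < κ ∧ Tendsto (fun s : ℝ =>
      (Nat.card {m : Multiset (HeightOneSpectrum (𝓞 K)) // (multisetNorm K m : ℝ) ≤ s} : ℝ) / s)
      atTop (𝓝 κ) := by
  refine ⟨_, dedekindZeta_residue_pos K, ?_⟩
  refine (NumberField.Ideal.tendsto_norm_le_div_atTop₀ K).congr fun s => ?_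
  congr 2
  refine (Nat.card_congr ((multisetEquivIdeal K).subtypeEquiv fun m => ?_)).symm
  rw [absNorm_multisetEquivIdeal]

theorem finite_multisetNorm_le (s : ℝ) :
    Finite {m : Multiset (HeightOneSpectrum (𝓞 K)) // (multisetNorm K m : ℝ) ≤ s} := by
  have : Finite {I : (Ideal (𝓞 K))⁰ // absNorm (I : Ideal (𝓞 K)) ≤ ⌊s⌋₊} :=
    Ideal.finite_setOfPred_absNorm_le₀ ⌊s⌋₊
  have hm (m : {m : Multiset (HeightOneSpectrum (𝓞 K)) // (multisetNorm K m : ℝ) ≤ s}) :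
      absNorm (multisetEquivIdeal K m.1 : Ideal (𝓞 K)) ≤ ⌊s⌋₊ := by
    rw [absNorm_multisetEquivIdeal]
    exact Nat.le_floor m.2
  exact Finite.of_injective
    (fun m => (⟨multisetEquivIdeal K m.1, hm m⟩ :
      {I : (Ideal (𝓞 K))⁰ // absNorm (I : Ideal (𝓞 K)) ≤ ⌊s⌋₊}))
    fun m n h => Subtype.ext ((multisetEquivIdeal K).injective (congrArg Subtype.val h))

/-- The quotient is a sum over `m` of terms `1 / s` (if `m` is counted) or `0`. Each term tends to 0
and is at most `1 / multisetNorm K m`, so dominated convergence applies. -/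
theorem tendsto_card_multisetNorm_le_zero
    (h : Summable fun m : Multiset (HeightOneSpectrum (𝓞 K)) => (1 / multisetNorm K m : ℝ)) :
    Tendsto (fun s : ℝ =>
      (Nat.card {m : Multiset (HeightOneSpectrum (𝓞 K)) // (multisetNorm K m : ℝ) ≤ s} : ℝ) / s)
      atTop (𝓝 0) := by
  classical
  have h0 : Tendsto (fun s : ℝ => ∑' m : Multiset (HeightOneSpectrum (𝓞 K)),
      if (multisetNorm K m : ℝ) ≤ s then 1 / s else 0) atTop
      (𝓝 (∑' _ : Multiset (HeightOneSpectrum (𝓞 K)), (0 : ℝ))) := by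
    refine tendsto_tsum_of_dominated_convergence h (fun m => ?_) ?_
    · refine squeeze_zero' (g := fun s : ℝ => 1 / s) ?_ ?_ ?_
      · filter_upwards [eventually_gt_atTop 0] with s hs
        split_ifs <;> positivity
      · filter_upwards [eventually_gt_atTop 0] with s hs
        split_ifs
        · exact le_rfl
        · positivity
      · simpa using tendsto_inv_atTop_zero (𝕜 := ℝ)
    · filter_upwards [eventually_gt_atTop 0] with s hs m
      have hm : (0 : ℝ) < multisetNorm K m := by exact_mod_cast multisetNorm_pos m
      split_ifs with hms
      · rw [Real.norm_of_nonneg (by positivity)]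
        exact one_div_le_one_div_of_le hm hms
      · rw [norm_zero]; positivity
  rw [tsum_zero] at h0
  refine h0.congr fun s => ?_
  have hfin := finite_multisetNorm_le (K := K) s
  have hfin' : {m : Multiset (HeightOneSpectrum (𝓞 K)) | (multisetNorm K m : ℝ) ≤ s}.Finite := hfin
  rw [tsum_eq_sum (s := hfin'.toFinset) fun m hm => if_neg fun h => hm (by simpa using h)]
  rw [Finset.sum_congr rfl fun m hm => if_pos (by simpa using hm), Finset.sum_const,
    nsmul_eq_mul, mul_one_div]
  congr 2
  exact (Nat.card_eq_card_finite_toFinset hfin').symm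

theorem multiset_map_add_map_injective {α β : Type*} {P Q : α → β} (hP : Function.Injective P)
    (hQ : Function.Injective Q) (hPQ : ∀ x y, P x ≠ Q y) {m n m' n' : Multiset α}
    (h : m.map P + n.map Q = m'.map P + n'.map Q) : m = m' ∧ n = n' := by
  classical
  have h1 (x : α) (n : Multiset α) : (n.map Q).count (P x) = 0 :=
    Multiset.count_eq_zero.2 fun hx => by
      obtain ⟨y, -, hy⟩ := Multiset.mem_map.1 hx
      exact hPQ x y hy.symm
  have h2 (x : α) (n : Multiset α) : (n.map P).count (Q x) = 0 :=
    Multiset.count_eq_zero.2 fun hx => by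
      obtain ⟨y, -, hy⟩ := Multiset.mem_map.1 hx
      exact hPQ y x hy
  refine ⟨Multiset.ext.2 fun x => ?_, Multiset.ext.2 fun x => ?_⟩
  · have := congrArg (Multiset.count (P x)) h
    simpa [h1, Multiset.count_map_eq_count' _ _ hP] using this
  · have := congrArg (Multiset.count (Q x)) h
    simpa [h2, Multiset.count_map_eq_count' _ _ hQ] using this

/-- The pair `(n, m)` is sent to `m.map P + n.map Q`. Disjointness of the ranges of `P` and `Q` lets
the pair be recovered by counting multiplicities. -/
theorem sum_card_multisetNorm_le {L : Type*} [Field L] [NumberField L]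
    {P Q : HeightOneSpectrum (𝓞 K) → HeightOneSpectrum (𝓞 L)}
    (hP : Function.Injective P) (hQ : Function.Injective Q) (hPQ : ∀ v w, P v ≠ Q w)
    (hPn : ∀ v, absNorm (P v).asIdeal ≤ absNorm v.asIdeal)
    (hQn : ∀ v, absNorm (Q v).asIdeal ≤ absNorm v.asIdeal)
    (T : Finset (Multiset (HeightOneSpectrum (𝓞 K)))) (s : ℝ) :
    ∑ n ∈ T, Nat.card {m : Multiset (HeightOneSpectrum (𝓞 K)) //
        (multisetNorm K m : ℝ) ≤ s / multisetNorm K n} ≤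
      Nat.card {l : Multiset (HeightOneSpectrum (𝓞 L)) // (multisetNorm L l : ℝ) ≤ s} := by
  have := finite_multisetNorm_le (K := L) s
  have hf (n : Multiset (HeightOneSpectrum (𝓞 K))) :=
    finite_multisetNorm_le (K := K) (s / multisetNorm K n)
  rw [← Finset.sum_coe_sort, ← Nat.card_sigma]
  refine Nat.card_le_card_of_injective (fun x => ⟨x.2.1.map P + x.1.1.map Q, ?_⟩) ?_
  · have h := x.2.2
    have hpos : (0 : ℝ) < multisetNorm K x.1.1 := by exact_mod_cast multisetNorm_pos _
    rw [le_div_iff₀ hpos] at h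
    refine le_trans ?_ h
    rw [multisetNorm_add]
    exact_mod_cast Nat.mul_le_mul (multisetNorm_map_le P hPn _) (multisetNorm_map_le Q hQn _)
  · rintro ⟨⟨n, hn⟩, m, hm⟩ ⟨⟨n', hn'⟩, m', hm'⟩ h
    obtain ⟨rfl, rfl⟩ := multiset_map_add_map_injective hP hQ hPQ (congrArg Subtype.val h)
    rfl

/-- The primes of a number field `K` cannot all have two different primes of residue degree one of
a number field `L` attached to them in an injective way: `L` would have too many ideals. -/
theorem false_of_two_families_of_primes {L : Type*} [Field L] [NumberField L]
    {P Q : HeightOneSpectrum (𝓞 K) → HeightOneSpectrum (𝓞 L)}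
    (hP : Function.Injective P) (hQ : Function.Injective Q) (hPQ : ∀ v w, P v ≠ Q w)
    (hPn : ∀ v, absNorm (P v).asIdeal ≤ absNorm v.asIdeal)
    (hQn : ∀ v, absNorm (Q v).asIdeal ≤ absNorm v.asIdeal) : False := by
  obtain ⟨κ, hκ, hK⟩ := exists_tendsto_card_multisetNorm_le K
  obtain ⟨κ', -, hL⟩ := exists_tendsto_card_multisetNorm_le L
  refine hκ.ne' (tendsto_nhds_unique hK (tendsto_card_multisetNorm_le_zero ?_))
  -- Dividing `sum_card_multisetNorm_le` by `s` and letting `s → ∞` bounds `κ * ∑ n ∈ T, 1 /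
  -- multisetNorm K n` by `κ'`. Summability would then force `κ = 0`.
  refine summable_of_sum_le (c := κ' / κ) (fun m => by positivity) fun T => ?_
  rw [le_div_iff₀ hκ, Finset.sum_mul]
  refine le_of_tendsto_of_tendsto (tendsto_finsetSum T fun n _ => ?_) hL (f := fun s => ∑ n ∈ T,
    (Nat.card {m : Multiset (HeightOneSpectrum (𝓞 K)) //
      (multisetNorm K m : ℝ) ≤ s / multisetNorm K n} : ℝ) / s) ?_
  · have hn : (0 : ℝ) < multisetNorm K n := by exact_mod_cast multisetNorm_pos n
    refine ((hK.comp (tendsto_id.atTop_div_const hn)).const_mul _).congr fun s => ?_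
    simp only [Function.comp_apply, id]
    field_simp
  · filter_upwards [eventually_gt_atTop 0] with s hs
    rw [← Finset.sum_div]
    gcongr
    exact_mod_cast sum_card_multisetNorm_le hP hQ hPQ hPn hQn T s

end IdealCount

open IsDedekindDomain NumberField Ideal Filter

/-! ### Primes attached to local embeddings, and squares at all finite places -/

section LocalPrimes

variable {F : Type*} [Field F] [NumberField F] {v : HeightOneSpectrum (𝓞 F)}

theorem exists_valued_sub_algebraMap_lt (x : v.adicCompletion F) {ε : v.adicCompletion F}
    (hε : ε ≠ 0) : ∃ f : F, Valued.v (x - algebraMap F (v.adicCompletion F) f) < Valued.v ε := by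
  have hopen : IsOpen {y : v.adicCompletion F | Valued.v (x - y) < Valued.v ε} := by
    have h := (Valued.isOpen_ball (v.adicCompletion F) (Valued.v.restrict ε)).preimage
      (continuous_const.sub continuous_id : Continuous fun y => x - y)
    simpa using h
  obtain ⟨f, hf⟩ := (v.denseRange_algebraMap F).exists_mem_open hopen
    ⟨x, by simpa [zero_lt_iff] using hε⟩
  exact ⟨f, hf⟩

theorem valued_algebraMap (f : F) :
    Valued.v (algebraMap F (v.adicCompletion F) f) = v.valuation F f :=
  HeightOneSpectrum.valuedAdicCompletion_eq_valuation' v f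

/-- The residue field of the completion is no larger than that of `𝓞 F` at `v`: approximate first by
an element of `F`, then by an integer. -/
theorem exists_valued_sub_ringOfIntegers_lt_one {x : v.adicCompletion F} (hx : Valued.v x ≤ 1) :
    ∃ r : 𝓞 F, Valued.v (x - algebraMap F (v.adicCompletion F) (algebraMap (𝓞 F) F r)) < 1 := by
  obtain ⟨f, hf⟩ := exists_valued_sub_algebraMap_lt x one_ne_zero
  rw [map_one] at hf
  have hf1 : v.valuation F f ≤ 1 := by
    rw [← valued_algebraMap (v := v)]
    have := Valued.v.map_sub_le hx hf.le
    simpa using this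
  obtain ⟨r, hr⟩ := v.exists_valuation_sub_lt_of_integer hf1 1
  refine ⟨r, ?_⟩
  rw [← valued_algebraMap (v := v), map_sub, Valuation.map_sub_swap] at hr
  have := Valued.v.map_add_lt hf hr
  simpa using this

theorem valued_le_one_of_isIntegral {x : v.adicCompletion F} (hx : IsIntegral ℤ x) :
    Valued.v x ≤ 1 := by
  have h : IsIntegral (v.adicCompletionIntegers F) x := hx.tower_top
  obtain ⟨y, rfl⟩ := IsIntegrallyClosed.isIntegral_iff.1 h
  exact y.2

theorem valued_map_ringOfIntegers_le_one {L : Type*} [Field L] [Algebra F L]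
    (φ : L →ₐ[F] v.adicCompletion F) (z : 𝓞 L) :
    Valued.v (φ (algebraMap (𝓞 L) L z)) ≤ 1 :=
  valued_le_one_of_isIntegral ((RingOfIntegers.isIntegral_coe z).map (φ.restrictScalars ℤ))

variable {L : Type*} [Field L] [NumberField L] [Algebra F L]

/-- The prime of `L` below the place defined by an embedding of `L` into a completion of `F`. -/
def primeOfEmbedding (φ : L →ₐ[F] v.adicCompletion F) : HeightOneSpectrum (𝓞 L) where
  asIdeal :=
    { carrier := {z | Valued.v (φ (algebraMap (𝓞 L) L z)) < 1}
      add_mem' := fun {x y} hx hy => by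
        simp only [Set.mem_ofPred_eq, map_add] at *
        exact Valued.v.map_add_lt hx hy
      zero_mem' := by simp
      smul_mem' := fun c x hx => by
        simp only [Set.mem_ofPred_eq, smul_eq_mul, map_mul] at *
        exact (mul_le_of_le_one_left' (valued_map_ringOfIntegers_le_one φ c)).trans_lt hx }
  isPrime := by
    refine ⟨fun h => ?_, fun {x y} hxy => ?_⟩
    · have : (1 : 𝓞 L) ∈ (⊤ : Ideal (𝓞 L)) := trivial
      rw [← h] at this
      simp at this
    · by_contra! hc
      simp only [Submodule.mem_mk, AddSubmonoid.mem_mk, AddSubsemigroup.mem_mk,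
        Set.mem_ofPred_eq, map_mul, not_lt] at hxy hc
      exact absurd (one_le_mul hc.1 hc.2) (not_le.2 hxy)
  ne_bot := by
    obtain ⟨r, hr, hr0⟩ := Submodule.exists_mem_ne_zero_of_ne_bot v.ne_bot
    intro h
    have hmem : algebraMap (𝓞 F) (𝓞 L) r ∈ (⊥ : Ideal (𝓞 L)) := by
      rw [← h]
      change Valued.v (φ (algebraMap (𝓞 L) L (algebraMap (𝓞 F) (𝓞 L) r))) < 1
      rw [← IsScalarTower.algebraMap_apply, IsScalarTower.algebraMap_apply (𝓞 F) F L,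
        AlgHom.commutes, valued_algebraMap, HeightOneSpectrum.valuation_lt_one_iff_mem]
      exact hr
    rw [Ideal.mem_bot, map_eq_zero_iff _ (FaithfulSMul.algebraMap_injective _ _)] at hmem
    exact hr0 hmem

theorem mem_primeOfEmbedding {φ : L →ₐ[F] v.adicCompletion F} {z : 𝓞 L} :
    z ∈ (primeOfEmbedding φ).asIdeal ↔ Valued.v (φ (algebraMap (𝓞 L) L z)) < 1 :=
  Iff.rfl

theorem algebraMap_mem_primeOfEmbedding {φ : L →ₐ[F] v.adicCompletion F} {r : 𝓞 F} :
    algebraMap (𝓞 F) (𝓞 L) r ∈ (primeOfEmbedding φ).asIdeal ↔ r ∈ v.asIdeal := by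
  rw [mem_primeOfEmbedding, ← IsScalarTower.algebraMap_apply,
    IsScalarTower.algebraMap_apply (𝓞 F) F L, AlgHom.commutes, valued_algebraMap,
    HeightOneSpectrum.valuation_lt_one_iff_mem]

/-- The prime has residue degree one: an integer of `L` lands in the local integers of `F`, where it
is congruent to an element of `𝓞 F`. Hence `𝓞 F ⧸ v` surjects onto the residue ring. -/
theorem absNorm_primeOfEmbedding_le (φ : L →ₐ[F] v.adicCompletion F) :
    absNorm (primeOfEmbedding φ).asIdeal ≤ absNorm v.asIdeal := by
  have : Finite (𝓞 F ⧸ v.asIdeal) := Ideal.finiteQuotientOfFreeOfNeBot _ v.ne_bot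
  have hle : v.asIdeal ≤ (primeOfEmbedding φ).asIdeal.comap (algebraMap (𝓞 F) (𝓞 L)) :=
    fun r hr => Ideal.mem_comap.2 (algebraMap_mem_primeOfEmbedding.2 hr)
  change Nat.card (𝓞 L ⧸ (primeOfEmbedding φ).asIdeal) ≤ Nat.card (𝓞 F ⧸ v.asIdeal)
  refine Nat.card_le_card_of_surjective (Ideal.quotientMap _ (algebraMap (𝓞 F) (𝓞 L)) hle) ?_
  intro q
  obtain ⟨z, rfl⟩ := Ideal.Quotient.mk_surjective q
  obtain ⟨r, hr⟩ :=
    exists_valued_sub_ringOfIntegers_lt_one (valued_map_ringOfIntegers_le_one φ z)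
  refine ⟨Ideal.Quotient.mk _ r, ?_⟩
  rw [Ideal.quotientMap_mk, Ideal.Quotient.eq, mem_primeOfEmbedding, map_sub, map_sub,
    Valuation.map_sub_swap, ← IsScalarTower.algebraMap_apply,
    IsScalarTower.algebraMap_apply (𝓞 F) F L, AlgHom.commutes]
  exact hr

theorem eq_of_primeOfEmbedding_eq {w : HeightOneSpectrum (𝓞 F)} {φ : L →ₐ[F] v.adicCompletion F}
    {ψ : L →ₐ[F] w.adicCompletion F} (h : primeOfEmbedding φ = primeOfEmbedding ψ) : v = w := by
  refine HeightOneSpectrum.ext (Ideal.ext fun r => ?_)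
  rw [← algebraMap_mem_primeOfEmbedding (φ := φ), h, algebraMap_mem_primeOfEmbedding]

/-- The prime controls integers only. To reach all of `L`, write `z = n / d` or `z = d / n` with `d`
outside the prime, so that `d` has value 1 under both embeddings; the second form contradicts `hz`.
-/
theorem valued_lt_one_of_primeOfEmbedding_eq {φ ψ : L →ₐ[F] v.adicCompletion F}
    (h : primeOfEmbedding φ = primeOfEmbedding ψ) {z : L} (hz : Valued.v (φ z) < 1) :
    Valued.v (ψ z) < 1 := by
  have key (n : 𝓞 L) : Valued.v (φ (algebraMap (𝓞 L) L n)) < 1 ↔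
      Valued.v (ψ (algebraMap (𝓞 L) L n)) < 1 := by
    rw [← mem_primeOfEmbedding, h, mem_primeOfEmbedding]
  have key1 {n : 𝓞 L} (χ : L →ₐ[F] v.adicCompletion F)
      (hn : ¬ Valued.v (χ (algebraMap (𝓞 L) L n)) < 1) :
      Valued.v (χ (algebraMap (𝓞 L) L n)) = 1 :=
    le_antisymm (valued_map_ringOfIntegers_le_one χ n) (not_lt.1 hn)
  obtain ⟨n, ⟨d, hd⟩, hnd | hnd⟩ :=
    (primeOfEmbedding φ).exists_primeCompl_mul_eq_or_mul_eq (K := L) z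
  · have hdφ : ¬ Valued.v (φ (algebraMap (𝓞 L) L d)) < 1 := hd
    have hdψ : ¬ Valued.v (ψ (algebraMap (𝓞 L) L d)) < 1 := by rwa [← key]
    have h1 := congrArg (fun x => Valued.v (φ x)) hnd
    have h2 := congrArg (fun x => Valued.v (ψ x)) hnd
    simp only [map_mul, key1 φ hdφ, key1 ψ hdψ, mul_one] at h1 h2
    rw [h2, ← key, ← h1]
    exact hz
  · have hdφ : ¬ Valued.v (φ (algebraMap (𝓞 L) L d)) < 1 := hd
    have h1 := congrArg (fun x => Valued.v (φ x)) hnd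
    simp only [map_mul, key1 φ hdφ] at h1
    exact absurd h1 ((mul_le_of_le_one_right' (valued_map_ringOfIntegers_le_one φ n)).trans_lt hz).ne

/-- Choose `f` in `F` closer to `φ z` than `ψ z` is, and `g` in `F` of the same size as `ψ z - φ z`.
Then `(z - f) / g` has value below 1 under `φ` and exactly 1 under `ψ`. -/
theorem primeOfEmbedding_ne {φ ψ : L →ₐ[F] v.adicCompletion F} {z : L}
    (hz : φ z ≠ ψ z) : primeOfEmbedding φ ≠ primeOfEmbedding ψ := by
  intro h
  have hne : ψ z - φ z ≠ 0 := sub_ne_zero.2 hz.symm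
  obtain ⟨f, hf⟩ := exists_valued_sub_algebraMap_lt (φ z) hne
  obtain ⟨g, hg⟩ := exists_valued_sub_algebraMap_lt (ψ z - φ z) hne
  have hg' : Valued.v (algebraMap F (v.adicCompletion F) g) = Valued.v (ψ z - φ z) := by
    have := Valued.v.map_sub_eq_of_lt_right hg
    rwa [sub_sub_cancel_left, Valuation.map_neg] at this
  have hg0 : algebraMap F (v.adicCompletion F) g ≠ 0 := by
    rw [← Valued.v.ne_zero_iff, hg']
    exact Valued.v.ne_zero_iff.2 hne
  have hφ : Valued.v (φ ((z - algebraMap F L f) / algebraMap F L g)) < 1 := by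
    rw [map_div₀, map_sub, AlgHom.commutes, AlgHom.commutes, map_div₀, hg']
    exact (div_lt_one₀ (zero_lt_iff.2 (Valued.v.ne_zero_iff.2 hne))).2 hf
  refine (valued_lt_one_of_primeOfEmbedding_eq h hφ).ne ?_
  rw [map_div₀, map_sub, AlgHom.commutes, AlgHom.commutes, map_div₀, hg',
    show ψ z - algebraMap F (v.adicCompletion F) f =
      (ψ z - φ z) + (φ z - algebraMap F (v.adicCompletion F) f) by ring,
    Valued.v.map_add_eq_of_lt_left hf]
  exact div_self (Valued.v.ne_zero_iff.2 hne)

/-- A number field `F` has no finite extension all of whose places over the finite places of `F`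
contain two of degree one. -/
theorem false_of_two_embeddings
    (φ ψ : ∀ v : HeightOneSpectrum (𝓞 F), L →ₐ[F] v.adicCompletion F)
    (z : HeightOneSpectrum (𝓞 F) → L) (hz : ∀ v, φ v (z v) ≠ ψ v (z v)) : False := by
  refine false_of_two_families_of_primes (P := fun v => primeOfEmbedding (φ v))
    (Q := fun v => primeOfEmbedding (ψ v)) (fun v w h => eq_of_primeOfEmbedding_eq h)
    (fun v w h => eq_of_primeOfEmbedding_eq h) (fun v w h => ?_)
    (fun v => absNorm_primeOfEmbedding_le _) (fun v => absNorm_primeOfEmbedding_le _)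
  obtain rfl := eq_of_primeOfEmbedding_eq h
  exact primeOfEmbedding_ne (hz v) h

/-- An element of a number field which is a square at all finite places is a square. -/
theorem isSquare_of_forall_isSquare_adicCompletion {d : F}
    (h : ∀ v : HeightOneSpectrum (𝓞 F), IsSquare (algebraMap F (v.adicCompletion F) d)) :
    IsSquare d := by
  by_contra hd
  have hd0 : d ≠ 0 := by
    rintro rfl
    exact hd (IsSquare.zero)
  have hirr : Irreducible (Polynomial.X ^ 2 - Polynomial.C d) := by
    refine X_pow_sub_C_irreducible_of_prime Nat.prime_two fun b hb => hd ⟨b, ?_⟩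
    rw [← hb, sq]
  have : Fact (Irreducible (Polynomial.X ^ 2 - Polynomial.C d)) := ⟨hirr⟩
  have hmonic : (Polynomial.X ^ 2 - Polynomial.C d).Monic :=
    Polynomial.monic_X_pow_sub_C d two_ne_zero
  have : FiniteDimensional F (AdjoinRoot (Polynomial.X ^ 2 - Polynomial.C d)) :=
    hmonic.finite_adjoinRoot
  have : NumberField (AdjoinRoot (Polynomial.X ^ 2 - Polynomial.C d)) :=
    NumberField.of_module_finite F _
  choose s hs using h
  -- The two embeddings of `F(√d)` send the root to `s v` and `-s v`.
  refine false_of_two_embeddings (L := AdjoinRoot (Polynomial.X ^ 2 - Polynomial.C d))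
    (fun v => AdjoinRoot.liftAlgHom _ (Algebra.ofId F _) (s v) ?_)
    (fun v => AdjoinRoot.liftAlgHom _ (Algebra.ofId F _) (-s v) ?_)
    (fun _ => AdjoinRoot.root _) fun v => ?_
  · simp [hs, sq]
  · simp [hs, sq]
  · have h2 : (2 : v.adicCompletion F) ≠ 0 := by
      rw [← map_ofNat (algebraMap F (v.adicCompletion F)) 2]
      exact (map_ne_zero _).2 two_ne_zero
    have hs0 : s v ≠ 0 := by
      intro h0
      have := hs v
      rw [h0, mul_zero, map_eq_zero] at this
      exact hd0 this
    simp only [AdjoinRoot.liftAlgHom_root]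
    intro hc
    have : 2 * s v = 0 := by linear_combination hc
    exact (mul_ne_zero h2 hs0) this

end LocalPrimes

/-! ### Positive determinant implies orientation-preserving isometry -/

section Geometry

open UpperHalfPlane

/-- Scaling by `1 / √det` leaves the fractional linear map unchanged. -/
theorem smul_eq_specialLinearGroup_smul {g : GL (Fin 2) ℝ} (hg : 0 < g.det.val) :
    ∃ s : Matrix.SpecialLinearGroup (Fin 2) ℝ, ∀ z : ℍ, g • z = s • z := by
  have hdet : 0 < (g : Matrix (Fin 2) (Fin 2) ℝ).det := hg
  set c : ℝ := (√(g : Matrix (Fin 2) (Fin 2) ℝ).det)⁻¹ with hc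
  have hc0 : c ≠ 0 := inv_ne_zero (Real.sqrt_ne_zero'.2 hdet)
  have h1 : (c • (g : Matrix (Fin 2) (Fin 2) ℝ)).det = 1 := by
    rw [Matrix.det_smul, Fintype.card_fin, hc, inv_pow, Real.sq_sqrt hdet.le]
    exact inv_mul_cancel₀ hdet.ne'
  obtain ⟨s, hs⟩ : ∃ s : Matrix.SpecialLinearGroup (Fin 2) ℝ,
      (s : Matrix (Fin 2) (Fin 2) ℝ) = c • (g : Matrix (Fin 2) (Fin 2) ℝ) := ⟨⟨_, h1⟩, rfl⟩
  refine ⟨s, fun z => ?_⟩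
  ext
  have hc' : (c : ℂ) ≠ 0 := by exact_mod_cast hc0
  have hentry (i j : Fin 2) : s i j = c * g i j := congrFun (congrFun hs i) j
  rw [coe_smul_of_det_pos hg, coe_specialLinearGroup_apply]
  simp only [num, denom, hentry, Algebra.algebraMap_self,
    RingHom.id_apply, Complex.ofReal_mul, mul_assoc, ← mul_add]
  rw [mul_div_mul_left _ _ hc']

theorem isometry_smul_of_det_pos {g : GL (Fin 2) ℝ} (hg : 0 < g.det.val) :
    Isometry fun z : ℍ => g • z := by
  obtain ⟨s, hs⟩ := smul_eq_specialLinearGroup_smul hg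
  simp only [hs]
  exact isometry_smul ℍ s

theorem isometry_piLp_map {ι : Type*} [Fintype ι] {X : ι → Type*}
    [∀ i, PseudoMetricSpace (X i)] {f : ∀ i, X i → X i} (hf : ∀ i, Isometry (f i)) :
    Isometry fun z : PiLp 2 X => (WithLp.toLp 2 fun i => f i (WithLp.ofLp z i) : PiLp 2 X) := by
  refine Isometry.of_dist_eq fun x y => ?_
  rw [PiLp.dist_eq_sum (by simp), PiLp.dist_eq_sum (by simp)]
  simp [(hf _).dist_eq]

/-- The map is complex linear, so its real determinant is the squared modulus of the complex one, `∏
c k`. -/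
theorem det_pi_restrictScalars_pos {r : ℕ} {c : Fin r → ℂ} (hc : ∀ k, c k ≠ 0) :
    0 < (ContinuousLinearMap.pi fun k =>
      ((ContinuousLinearMap.toSpanSingleton ℂ (c k)).restrictScalars ℝ).comp
        (ContinuousLinearMap.proj k : (Fin r → ℂ) →L[ℝ] ℂ)).det := by
  have h : ((ContinuousLinearMap.pi fun k =>
      ((ContinuousLinearMap.toSpanSingleton ℂ (c k)).restrictScalars ℝ).comp
        (ContinuousLinearMap.proj k : (Fin r → ℂ) →L[ℝ] ℂ)) : (Fin r → ℂ) →ₗ[ℝ] (Fin r → ℂ)) =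
      (Matrix.toLin' (Matrix.diagonal c)).restrictScalars ℝ := by
    ext x k
    simp [Matrix.mulVec_diagonal, mul_comm]
  rw [ContinuousLinearMap.det, h, LinearMap.det_restrictScalars, LinearMap.det_toLin',
    Matrix.det_diagonal, Algebra.norm_complex_eq]
  exact Complex.normSq_pos.2 (Finset.prod_ne_zero_iff.2 fun k _ => hc k)

theorem isOrientationPreservingIsometry_smul {r : ℕ} {g : Fin r → GL (Fin 2) ℝ}
    (hg : ∀ k, 0 < (g k).det.val) :
    IsOrientationPreservingIsometry fun z : Fin r → ℍ => fun k => g k • z k := by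
  refine ⟨isometry_piLp_map (f := fun k z => g k • z) fun k => isometry_smul_of_det_pos (hg k),
    fun z => ⟨_, ?_, det_pi_restrictScalars_pos
      (c := fun k => ((g k).val.det : ℂ) / denom (g k) (z k) ^ 2) fun k => ?_⟩⟩
  · refine hasFDerivAt_pi.2 fun k => ?_
    have h := ((hasStrictDerivAt_smul (hg k) (z k)).hasDerivAt.hasFDerivAt).restrictScalars ℝ
    exact h.comp (fun k => (z k : ℂ)) (ContinuousLinearMap.proj (R := ℝ) k).hasFDerivAt
  · exact div_ne_zero (by exact_mod_cast (hg k).ne') (pow_ne_zero _ (denom_ne_zero _ _))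

end Geometry

/-! ### Reduced norm and determinant -/

section Determinant

/-- A matrix algebra isomorphism takes quaternions of positive reduced norm to matrices of positive
determinant. -/
theorem det_pos_of_nrd_pos {a b : ℝ} (τ : Quat a b ≃ₐ[ℝ] Matrix (Fin 2) (Fin 2) ℝ) {q : Quat a b}
    (hq : 0 < nrd a b q) : 0 < (τ q).det := by
  -- This quadratic equation passes to `M = τ q`. If `M` has trace `2 * q.re`, its determinant is
  -- `nrd a b q`; otherwise `M 0 1 = 0` and the diagonal entries agree, so the determinant is a
  -- nonzero square.
  have h1 : q * q = (2 * q.re) • q - nrd a b q • (1 : Quat a b) := by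
    ext <;> simp [nrd] <;> ring
  have h2 := congrArg τ h1
  rw [map_mul, map_sub, map_smul, map_smul, map_one] at h2
  set M := τ q
  generalize nrd a b q = n at *
  generalize 2 * q.re = t at *
  have e00 := congrFun (congrFun h2 0) 0
  have e01 := congrFun (congrFun h2 0) 1
  have e10 := congrFun (congrFun h2 1) 0
  have e11 := congrFun (congrFun h2 1) 1
  simp [Matrix.mul_apply, Fin.sum_univ_two] at e00 e01 e10 e11
  rw [Matrix.det_fin_two]
  by_cases ht : M 0 0 + M 1 1 = t
  · have : M 0 0 * M 1 1 - M 0 1 * M 1 0 = n := by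
      rw [← ht] at e00
      linear_combination -e00
    rwa [this]
  · have ht' : M 0 0 + M 1 1 - t ≠ 0 := sub_ne_zero.2 ht
    have h01 : M 0 1 = 0 := (mul_eq_zero.1 (show (M 0 0 + M 1 1 - t) * M 0 1 = 0 by
      linear_combination e01)).resolve_left ht'
    have hd : M 0 0 - M 1 1 = 0 := (mul_eq_zero.1 (show (M 0 0 + M 1 1 - t) * (M 0 0 - M 1 1) = 0 by
      linear_combination e00 - e11)).resolve_left ht'
    rw [h01] at e00 ⊢
    have h00 : M 0 0 ≠ 0 := by
      intro h0
      rw [h0] at e00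
      apply hq.ne'
      linear_combination e00
    have : 0 < M 0 0 ^ 2 := by positivity
    nlinarith [sub_eq_zero.1 hd]

end Determinant

/-! ### The line of candidates for the first factor -/

section LinearAlgebra

variable {F : Type*} [Field F]

/-- The coordinate of a quaternion along `i`, `j` or `k`. -/
def imCoord {R : Type*} [CommRing R] {a b : R} (x : Quat a b) : Fin 3 → R :=
  ![x.imI, x.imJ, x.imK]

/-- Commuting quaternions have proportional imaginary parts, since the cross product vanishes. -/
theorem eq_coe_of_commute [CharZero F] {a b : F} (ha : a ≠ 0) (hb : b ≠ 0) {x β : Quat a b}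
    (h : x * β = β * x) {m : Fin 3} (hβ : imCoord β m ≠ 0) (hx : imCoord x m = 0) :
    x = (x.re : Quat a b) := by
  rw [QuaternionAlgebra.ext_iff] at h
  obtain ⟨-, hI, hJ, hK⟩ := h
  simp at hI hJ hK
  have h2 : (2 : F) ≠ 0 := two_ne_zero
  have eI : x.imJ * β.imK = x.imK * β.imJ := mul_left_cancel₀ (mul_ne_zero h2 hb) (by
    linear_combination -hI)
  have eJ : x.imI * β.imK = x.imK * β.imI := mul_left_cancel₀ (mul_ne_zero h2 ha) (by
    linear_combination hJ)
  have eK : x.imI * β.imJ = x.imJ * β.imI := mul_left_cancel₀ h2 (by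
    linear_combination hK)
  have : x.imI = 0 ∧ x.imJ = 0 ∧ x.imK = 0 := by
    fin_cases m <;> simp [imCoord] at hβ hx <;> simp_all
  ext <;> simp [this]

theorem exists_imCoord_ne_zero {R : Type*} [CommRing R] {a b : R} {β : Quat a b}
    (h : β ≠ (β.re : Quat a b)) : ∃ m, imCoord β m ≠ 0 := by
  by_contra! hc
  have h0 := hc 0
  have h1 := hc 1
  have h2 := hc 2
  simp [imCoord] at h0 h1 h2
  exact h (by ext <;> simp [*])

variable {K : Type*} [Field K] [Algebra F K]

/-- Apply a linear functional `K → F` to the coordinates of a quaternion over `K`. -/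
def Quat.mapFunctional (l : K →ₗ[F] F) (a b : F)
    (p : Quat (algebraMap F K a) (algebraMap F K b)) : Quat a b :=
  ⟨l p.re, l p.imI, l p.imJ, l p.imK⟩

theorem map_algebraMap_mul (l : K →ₗ[F] F) (c : F) (x : K) :
    l (algebraMap F K c * x) = c * l x := by
  rw [← Algebra.smul_def, map_smul, smul_eq_mul]

theorem map_mul_algebraMap (l : K →ₗ[F] F) (c : F) (x : K) :
    l (x * algebraMap F K c) = l x * c := by
  rw [mul_comm, map_algebraMap_mul, mul_comm]

theorem mapFunctional_map_mul (l : K →ₗ[F] F) {a b : F} (c : Quat a b)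
    (p : Quat (algebraMap F K a) (algebraMap F K b)) :
    Quat.mapFunctional l a b (Quat.map (algebraMap F K) a b c * p) =
      c * Quat.mapFunctional l a b p := by
  ext <;> simp [Quat.mapFunctional, Quat.map, map_algebraMap_mul, mul_assoc]

theorem mapFunctional_mul_map (l : K →ₗ[F] F) {a b : F} (c : Quat a b)
    (p : Quat (algebraMap F K a) (algebraMap F K b)) :
    Quat.mapFunctional l a b (p * Quat.map (algebraMap F K) a b c) =
      Quat.mapFunctional l a b p * c := by
  ext <;> simp [Quat.mapFunctional, Quat.map, map_algebraMap_mul, map_mul_algebraMap, mul_assoc]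

/-- The quaternions which commute with `β` and whose left multiple by `δ` commutes with `α` form a
line defined over the base field, unless `1` is one of them. -/
theorem exists_generator_of_commute [CharZero F] {ι : Type*} {K : ι → Type*} [∀ v, Field (K v)]
    [∀ v, Algebra F (K v)] {a b : F} (ha : a ≠ 0) (hb : b ≠ 0)
    {α β δ : Quat a b} (hβ : β ≠ (β.re : Quat a b)) (hδ : δ * α ≠ α * δ) :
    ∃ x : Quat a b, (x * β = β * x ∧ δ * x * α = α * (δ * x)) ∧
      ∀ v (p : Quat (algebraMap F (K v) a) (algebraMap F (K v) b)),
        p * Quat.map (algebraMap F (K v)) a b β = Quat.map (algebraMap F (K v)) a b β * p →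
        Quat.map (algebraMap F (K v)) a b δ * p * Quat.map (algebraMap F (K v)) a b α =
          Quat.map (algebraMap F (K v)) a b α * (Quat.map (algebraMap F (K v)) a b δ * p) →
        ∃ c : K v, p = c • Quat.map (algebraMap F (K v)) a b x := by
  obtain ⟨m, hm⟩ := exists_imCoord_ne_zero hβ
  let V : Submodule F (Quat a b) :=
    { carrier := {x | x * β = β * x ∧ δ * x * α = α * (δ * x)}
      zero_mem' := by simp
      add_mem' := fun {x y} hx hy => by
        simp only [Set.mem_ofPred_eq, add_mul, mul_add] at *
        exact ⟨by rw [hx.1, hy.1], by rw [hx.2, hy.2]⟩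
      smul_mem' := fun c x hx => by
        simp only [Set.mem_ofPred_eq, smul_mul_assoc, mul_smul_comm] at *
        exact ⟨by rw [hx.1], by rw [hx.2]⟩ }
  -- The coordinate `m` is injective on `V`, so `V` has dimension at most one: an element with zero
  -- coordinate is a scalar, and a nonzero scalar would make `δ` commute with `α`.
  have hzero : ∀ x ∈ V, imCoord x m = 0 → x = 0 := by
    intro x hx hx0
    have hxe := eq_coe_of_commute ha hb hx.1 hm hx0
    have h2 := hx.2
    by_contra hne
    have hr : x.re ≠ 0 := by
      intro h
      rw [h] at hxe
      exact hne (by simpa using hxe)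
    rw [hxe, (QuaternionAlgebra.coe_commutes x.re δ).symm, mul_assoc, ← mul_assoc α,
      ← QuaternionAlgebra.coe_commutes x.re α, mul_assoc, QuaternionAlgebra.coe_mul_eq_smul,
      QuaternionAlgebra.coe_mul_eq_smul] at h2
    exact hδ (smul_right_injective _ hr h2)
  obtain ⟨x, hxV, hx⟩ : ∃ x ∈ V, ∀ y ∈ V, y = imCoord y m • x := by
    by_cases h : ∃ x ∈ V, imCoord x m ≠ 0
    · obtain ⟨x, hxV, hx⟩ := h
      refine ⟨(imCoord x m)⁻¹ • x, V.smul_mem _ hxV, fun y hy => ?_⟩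
      rw [← sub_eq_zero]
      refine hzero _ (V.sub_mem hy (V.smul_mem _ (V.smul_mem _ hxV))) ?_
      have : ∀ z : Quat a b, ∀ c : F, imCoord (y - c • z) m = imCoord y m - c * imCoord z m := by
        intro z c
        fin_cases m <;> simp [imCoord]
      rw [smul_smul, this, inv_mul_cancel_right₀ hx, sub_self]
    · push Not at h
      exact ⟨0, V.zero_mem, fun y hy => by rw [smul_zero]; exact hzero y hy (h y hy)⟩
  refine ⟨x, hxV, fun v p h1 h2 => ⟨imCoord p m, ?_⟩⟩
  -- The equations have coefficients in `F`, so applying an `F`-linear functional to the coordinates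
  -- of a local solution gives an element of `V`. Functionals separate the points of `K v`, which
  -- yields `p = imCoord p m • x`.
  have key (l : K v →ₗ[F] F) : Quat.mapFunctional l a b p = l (imCoord p m) • x := by
    have hl : Quat.mapFunctional l a b p ∈ V := by
      refine ⟨?_, ?_⟩
      · rw [← mapFunctional_mul_map, h1, mapFunctional_map_mul]
      · rw [← mapFunctional_map_mul, ← mapFunctional_mul_map, h2, mapFunctional_map_mul]
    have : imCoord (Quat.mapFunctional l a b p) m = l (imCoord p m) := by
      fin_cases m <;> rfl
    rw [← this]
    exact hx _ hl
  have dual {y z : K v} (h : ∀ l : K v →ₗ[F] F, l y = l z) : y = z := by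
    rw [← sub_eq_zero, ← Module.forall_dual_apply_eq_zero_iff F]
    intro l
    rw [map_sub, h l, sub_self]
  have key' (l : K v →ₗ[F] F) := QuaternionAlgebra.ext_iff.1 (key l)
  ext
  · refine dual fun l => ?_
    simpa [Quat.map, map_mul_algebraMap, Quat.mapFunctional] using (key' l).1
  · refine dual fun l => ?_
    simpa [Quat.map, map_mul_algebraMap, Quat.mapFunctional] using (key' l).2.1
  · refine dual fun l => ?_
    simpa [Quat.map, map_mul_algebraMap, Quat.mapFunctional] using (key' l).2.2.1
  · refine dual fun l => ?_
    simpa [Quat.map, map_mul_algebraMap, Quat.mapFunctional] using (key' l).2.2.2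

end LinearAlgebra

/-! ### From the adelic closure to local factorizations -/

section Compactness

open IsDedekindDomain NumberField

variable {F : Type*} [Field F] [NumberField F]

open Valued in
theorem compactSpace_adicCompletionIntegers (v : HeightOneSpectrum (𝓞 F)) :
    CompactSpace (v.adicCompletionIntegers F) := by
  have : IsDiscreteValuationRing 𝒪[v.adicCompletion F] :=
    inferInstanceAs (IsDiscreteValuationRing (v.adicCompletionIntegers F))
  have hcomp : CompleteSpace 𝒪[v.adicCompletion F] :=
    (Valued.isClosed_integer (v.adicCompletion F)).completeSpace_coe
  have hmem (x : v.adicCompletionIntegers F) :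
      x ∈ IsLocalRing.maximalIdeal (v.adicCompletionIntegers F) ↔
        Valued.v (x : v.adicCompletion F) < 1 :=
    Valuation.mem_maximalIdeal_iff _ _
  have hfin : Finite (IsLocalRing.ResidueField (v.adicCompletionIntegers F)) := by
    have : Finite (𝓞 F ⧸ v.asIdeal) := Ideal.finiteQuotientOfFreeOfNeBot _ v.ne_bot
    let f : 𝓞 F →+* IsLocalRing.ResidueField (v.adicCompletionIntegers F) :=
      (IsLocalRing.residue _).comp (algebraMap (𝓞 F) (v.adicCompletionIntegers F))
    refine Finite.of_surjective (Ideal.Quotient.lift v.asIdeal f fun r hr => ?_) fun q => ?_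
    · rw [RingHom.comp_apply, IsLocalRing.residue_eq_zero_iff, hmem]
      change Valued.v (algebraMap F (v.adicCompletion F) (algebraMap (𝓞 F) F r)) < 1
      rwa [valued_algebraMap, HeightOneSpectrum.valuation_lt_one_iff_mem]
    · obtain ⟨x, rfl⟩ := IsLocalRing.residue_surjective q
      obtain ⟨r, hr⟩ := exists_valued_sub_ringOfIntegers_lt_one x.2
      refine ⟨Ideal.Quotient.mk _ r, ?_⟩
      rw [Ideal.Quotient.lift_mk, RingHom.comp_apply, eq_comm, ← sub_eq_zero, ← map_sub,
        IsLocalRing.residue_eq_zero_iff, hmem]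
      exact hr
  exact Valued.integer.compactSpace_iff_completeSpace_and_isDiscreteValuationRing_and_finite_residueField.2
    ⟨hcomp, this, hfin⟩

/-- The four coordinates of a quaternion. -/
def coords {R : Type*} [CommRing R] {a b : R} (x : Quat a b) : R × R × R × R :=
  (x.re, x.imI, x.imJ, x.imK)

theorem coords_injective {R : Type*} [CommRing R] {a b : R} :
    Function.Injective (coords : Quat a b → R × R × R × R) := by
  intro x y h
  simp only [coords, Prod.mk.injEq] at h
  exact QuaternionAlgebra.ext h.1 h.2.1 h.2.2.1 h.2.2.2

theorem continuous_coords_mul {R X : Type*} [CommRing R] [TopologicalSpace R] [IsTopologicalRing R]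
    [TopologicalSpace X] {a b : R} {f g : X → Quat a b} (hf : Continuous fun x => coords (f x))
    (hg : Continuous fun x => coords (g x)) : Continuous fun x => coords (f x * g x) := by
  simp only [coords, continuous_prodMk] at *
  obtain ⟨hf0, hf1, hf2, hf3⟩ := hf
  obtain ⟨hg0, hg1, hg2, hg3⟩ := hg
  simp only [QuaternionAlgebra.re_mul, QuaternionAlgebra.imI_mul, QuaternionAlgebra.imJ_mul,
    QuaternionAlgebra.imK_mul]
  refine ⟨?_, ?_, ?_, ?_⟩ <;> fun_prop

theorem continuous_nrd {R X : Type*} [CommRing R] [TopologicalSpace R] [IsTopologicalRing R]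
    [TopologicalSpace X] {a b : R} {f : X → Quat a b} (hf : Continuous fun x => coords (f x)) :
    Continuous fun x => nrd a b (f x) := by
  simp only [coords, continuous_prodMk] at hf
  obtain ⟨hf0, hf1, hf2, hf3⟩ := hf
  simp only [nrd, MonoidHom.coe_mk, OneHom.coe_mk]
  fun_prop

/-- Norm and commutation conditions cut out a closed subset of a compact box, and multiplication is
continuous. -/
theorem isCompact_image_mul {R : Type*} [CommRing R] [TopologicalSpace R] [IsTopologicalRing R]
    [T2Space R] {O : Set R} (hO : IsCompact O) {a b : R} (α β : Quat a b) :
    IsCompact {c : R × R × R × R | ∃ p q : Quat a b, coords p ∈ O ×ˢ O ×ˢ O ×ˢ O ∧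
      coords q ∈ O ×ˢ O ×ˢ O ×ˢ O ∧ nrd a b p = 1 ∧ nrd a b q = 1 ∧
      p * β = β * p ∧ q * α = α * q ∧ coords (p * q) = c} := by
  let mk : R × R × R × R → Quat a b := fun c => ⟨c.1, c.2.1, c.2.2.1, c.2.2.2⟩
  have hmk : ∀ c, coords (mk c) = c := fun c => rfl
  have hmk' : ∀ p, mk (coords p) = p := fun p => rfl
  let B := O ×ˢ O ×ˢ O ×ˢ O
  have hB : IsCompact B := hO.prod (hO.prod (hO.prod hO))
  have h1 : Continuous fun c : (R × R × R × R) × (R × R × R × R) => coords (mk c.1) :=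
    continuous_fst
  have h2 : Continuous fun c : (R × R × R × R) × (R × R × R × R) => coords (mk c.2) :=
    continuous_snd
  have hc (u : Quat a b) :
      Continuous fun _ : (R × R × R × R) × (R × R × R × R) => coords u := continuous_const
  let C : Set ((R × R × R × R) × (R × R × R × R)) :=
    {c | nrd a b (mk c.1) = 1 ∧ nrd a b (mk c.2) = 1 ∧
      coords (mk c.1 * β) = coords (β * mk c.1) ∧ coords (mk c.2 * α) = coords (α * mk c.2)}
  have hC : IsClosed C :=
    ((isClosed_eq (continuous_nrd h1) continuous_const).inter
      ((isClosed_eq (continuous_nrd h2) continuous_const).inter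
        ((isClosed_eq (continuous_coords_mul h1 (hc β)) (continuous_coords_mul (hc β) h1)).inter
          (isClosed_eq (continuous_coords_mul h2 (hc α)) (continuous_coords_mul (hc α) h2)))))
  have himg := ((hB.prod hB).inter_right hC).image (continuous_coords_mul h1 h2)
  convert himg using 1
  ext c
  constructor
  · rintro ⟨p, q, hp, hq, hp1, hq1, hpβ, hqα, rfl⟩
    exact ⟨(coords p, coords q), ⟨⟨hp, hq⟩, hp1, hq1, congrArg coords hpβ, congrArg coords hqα⟩, rfl⟩
  · rintro ⟨⟨p, q⟩, ⟨⟨hp, hq⟩, hp1, hq1, hpβ, hqα⟩, rfl⟩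
    exact ⟨mk p, mk q, hp, hq, hp1, hq1, coords_injective hpβ, coords_injective hqα, rfl⟩

/-- An element of the closure of `C(β) C(α)` is a product of local elements of reduced norm one
commuting with `β` and `α`. -/
theorem exists_local_factorization {a b : 𝓞 F} {α β : (DAlg a b)ˣ} {γ : SL a b}
    (hγ : toHat a b γ ∈ closure[SL.topology _ _] (toHat a b ''
      {g | ∃ u ∈ centralizerInLambda a b β, ∃ w ∈ centralizerInLambda a b α, g = u * w}))
    (v : HeightOneSpectrum (𝓞 F)) :
    ∃ p q : Quat (algebraMap F (v.adicCompletion F) (algebraMap (𝓞 F) F a))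
        (algebraMap F (v.adicCompletion F) (algebraMap (𝓞 F) F b)),
      nrd _ _ p = 1 ∧ nrd _ _ q = 1 ∧
      p * Quat.map (algebraMap F (v.adicCompletion F)) _ _ (β : DAlg a b) =
        Quat.map (algebraMap F (v.adicCompletion F)) _ _ (β : DAlg a b) * p ∧
      q * Quat.map (algebraMap F (v.adicCompletion F)) _ _ (α : DAlg a b) =
        Quat.map (algebraMap F (v.adicCompletion F)) _ _ (α : DAlg a b) * q ∧
      p * q = Quat.map (algebraMap F (v.adicCompletion F)) _ _ (toD a b γ : DAlg a b) := by
  have hO : IsCompact (v.adicCompletionIntegers F : Set (v.adicCompletion F)) :=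
    isCompact_iff_compactSpace.2 (compactSpace_adicCompletionIntegers v)
  let j := Quat.map (algebraMap F (v.adicCompletion F)) (algebraMap (𝓞 F) F a)
    (algebraMap (𝓞 F) F b)
  have hK := (isCompact_image_mul hO (j α) (j β)).isClosed
  let pr : Quat (algebraMap (𝓞 F) (IntegralFiniteAdeles F) a)
      (algebraMap (𝓞 F) (IntegralFiniteAdeles F) b) →
      v.adicCompletion F × v.adicCompletion F × v.adicCompletion F × v.adicCompletion F :=
    fun x => (x.re v, x.imI v, x.imJ v, x.imK v)
  let ev : SL (algebraMap (𝓞 F) (IntegralFiniteAdeles F) a)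
      (algebraMap (𝓞 F) (IntegralFiniteAdeles F) b) →
      v.adicCompletion F × v.adicCompletion F × v.adicCompletion F × v.adicCompletion F :=
    fun g => pr (Units.val g.1)
  have hev : @Continuous _ _ (SL.topology _ _) _ ev := by
    have h : Continuous fun c : IntegralFiniteAdeles F × IntegralFiniteAdeles F ×
        IntegralFiniteAdeles F × IntegralFiniteAdeles F =>
        ((c.1 v : v.adicCompletion F), (c.2.1 v : v.adicCompletion F),
          (c.2.2.1 v : v.adicCompletion F), (c.2.2.2 v : v.adicCompletion F)) := by
      fun_prop
    let _ := SL.topology (algebraMap (𝓞 F) (IntegralFiniteAdeles F) a)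
      (algebraMap (𝓞 F) (IntegralFiniteAdeles F) b)
    have hd : Continuous fun g : SL (algebraMap (𝓞 F) (IntegralFiniteAdeles F) a)
        (algebraMap (𝓞 F) (IntegralFiniteAdeles F) b) => coords (Units.val g.1) :=
      continuous_induced_dom
    exact h.comp hd
  have hevj (g : SL a b) : ev (toHat a b g) = coords (j (toD a b g : DAlg a b)) := rfl
  have hnrd (g : SL a b) : nrd _ _ (j (toD a b g : DAlg a b)) = 1 := by
    have h : nrd a b ((g : (Quat a b)ˣ) : Quat a b) = 1 := congrArg Units.val g.2
    change nrd _ _ (Quat.map _ _ _ (Quat.map (algebraMap (𝓞 F) F) a b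
      ((g : (Quat a b)ˣ) : Quat a b))) = 1
    rw [nrd_map, nrd_map, h, map_one, map_one]
  have hint (g : SL a b) : coords (j (toD a b g : DAlg a b)) ∈
      (v.adicCompletionIntegers F : Set (v.adicCompletion F)) ×ˢ
        (v.adicCompletionIntegers F : Set (v.adicCompletion F)) ×ˢ
        (v.adicCompletionIntegers F : Set (v.adicCompletion F)) ×ˢ
        (v.adicCompletionIntegers F : Set (v.adicCompletion F)) :=
    ⟨HeightOneSpectrum.coe_algebraMap_mem _ _ v _, HeightOneSpectrum.coe_algebraMap_mem _ _ v _,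
      HeightOneSpectrum.coe_algebraMap_mem _ _ v _, HeightOneSpectrum.coe_algebraMap_mem _ _ v _⟩
  have hcomm (δ : (DAlg a b)ˣ) (g : SL a b) (hg : g ∈ centralizerInLambda a b δ) :
      j (toD a b g : DAlg a b) * j δ = j δ * j (toD a b g : DAlg a b) := by
    have h : δ * toD a b g = toD a b g * δ := Subgroup.mem_centralizer_iff.1 hg δ rfl
    rw [← map_mul, ← map_mul, ← Units.val_mul, ← h, Units.val_mul]
  let _ := SL.topology (algebraMap (𝓞 F) (IntegralFiniteAdeles F) a)
    (algebraMap (𝓞 F) (IntegralFiniteAdeles F) b)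
  -- The preimage of the compact set under the `v`-component is closed and contains all the global
  -- products, hence their closure.
  have hsub := closure_minimal (s := toHat a b ''
      {g | ∃ u ∈ centralizerInLambda a b β, ∃ w ∈ centralizerInLambda a b α, g = u * w}) ?_
      (hK.preimage hev)
  · obtain ⟨p, q, -, -, hp, hq, hpβ, hqα, hpq⟩ := hsub hγ
    exact ⟨p, q, hp, hq, hpβ, hqα, coords_injective hpq⟩
  · rintro _ ⟨_, ⟨u, hu, w, hw, rfl⟩, rfl⟩
    refine ⟨j (toD a b u : DAlg a b), j (toD a b w : DAlg a b), hint u, hint w, hnrd u, hnrd w,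
      hcomm β u hu, hcomm α w hw, ?_⟩
    rw [hevj, map_mul, Units.val_mul, map_mul]

end Compactness

/-! ### From local to global factorizations -/

section Main

open IsDedekindDomain NumberField

theorem mul_star_eq_one {R : Type*} [CommRing R] {a b : R} {q : Quat a b} (hq : nrd a b q = 1) :
    q * star q = 1 ∧ star q * q = 1 := by
  simp only [nrd, MonoidHom.coe_mk, OneHom.coe_mk] at hq
  constructor <;> ext <;> simp <;> first | ring1 | linear_combination hq

theorem star_mul_comm_of_nrd_eq_one {R : Type*} [CommRing R] {a b : R} {q α : Quat a b}
    (hq : nrd a b q = 1) (h : q * α = α * q) : star q * α = α * star q := by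
  have h1 : star q * (α * q) * star q = star q * α := by
    rw [mul_assoc, mul_assoc, (mul_star_eq_one hq).1, mul_one]
  rw [← h1, ← h, ← mul_assoc, (mul_star_eq_one hq).2, one_mul]

theorem nrd_smul {R : Type*} [CommRing R] {a b : R} (c : R) (x : Quat a b) :
    nrd a b (c • x) = c ^ 2 * nrd a b x := by
  simp [nrd]
  ring

/-- Local products at all finite places of elements of reduced norm one in two centralizers are
global products of such elements. -/
theorem exists_global_factorization {F : Type*} [Field F] [NumberField F] {a b : 𝓞 F}
    (ha : a ≠ 0) (hb : b ≠ 0) {α β γ : (DAlg a b)ˣ}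
    (hβ : (β : DAlg a b) ≠ ((β : DAlg a b).re : DAlg a b))
    (h : ∀ v : HeightOneSpectrum (𝓞 F),
      ∃ p q : Quat (algebraMap F (v.adicCompletion F) (algebraMap (𝓞 F) F a))
        (algebraMap F (v.adicCompletion F) (algebraMap (𝓞 F) F b)),
      nrd _ _ p = 1 ∧ nrd _ _ q = 1 ∧
      p * Quat.map (algebraMap F (v.adicCompletion F)) _ _ (β : DAlg a b) =
        Quat.map (algebraMap F (v.adicCompletion F)) _ _ (β : DAlg a b) * p ∧
      q * Quat.map (algebraMap F (v.adicCompletion F)) _ _ (α : DAlg a b) =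
        Quat.map (algebraMap F (v.adicCompletion F)) _ _ (α : DAlg a b) * q ∧
      p * q = Quat.map (algebraMap F (v.adicCompletion F)) _ _ (γ : DAlg a b)) :
    ∃ x ∈ Subgroup.centralizer {β}, ∃ y ∈ Subgroup.centralizer {α},
      γ = x * y ∧ nrd _ _ (x : DAlg a b) = 1 := by
  by_cases hγ : γ⁻¹ * α = α * γ⁻¹
  · refine ⟨1, Subgroup.one_mem _, γ, ?_, (one_mul γ).symm, by simp⟩
    rw [← Subgroup.inv_mem_iff, Subgroup.mem_centralizer_singleton_iff]
    exact hγ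
  have hγ' : ((γ⁻¹ : (DAlg a b)ˣ) : DAlg a b) * α ≠ α * ((γ⁻¹ : (DAlg a b)ˣ) : DAlg a b) :=
    fun h => hγ (Units.ext h)
  have ha' : algebraMap (𝓞 F) F a ≠ 0 := by simpa using ha
  have hb' : algebraMap (𝓞 F) F b ≠ 0 := by simpa using hb
  obtain ⟨x, ⟨hxβ, hxα⟩, hx⟩ := exists_generator_of_commute
    (K := fun v : HeightOneSpectrum (𝓞 F) => v.adicCompletion F) ha' hb' hβ hγ'
  -- Here `γ⁻¹ * p = q⁻¹ = star q` commutes with `α`, so `p = c • x`; then compare norms.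
  have hloc (v : HeightOneSpectrum (𝓞 F)) :
      ∃ c, c ^ 2 * algebraMap F (v.adicCompletion F) (nrd _ _ x) = 1 := by
    obtain ⟨p, q, hp, hq, hpβ, hqα, hpq⟩ := h v
    have hδ : Quat.map (algebraMap F (v.adicCompletion F)) _ _
        ((γ⁻¹ : (DAlg a b)ˣ) : DAlg a b) * p = star q := by
      have h1 : Quat.map (algebraMap F (v.adicCompletion F)) _ _
          ((γ⁻¹ : (DAlg a b)ˣ) : DAlg a b) * (p * q) = 1 := by
        rw [hpq, ← map_mul, Units.inv_mul, map_one]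
      rw [← one_mul (star q), ← h1, mul_assoc, mul_assoc, (mul_star_eq_one hq).1, mul_one]
    obtain ⟨c, hc⟩ := hx v p hpβ (by rw [hδ, star_mul_comm_of_nrd_eq_one hq hqα])
    refine ⟨c, ?_⟩
    rw [← nrd_map, ← nrd_smul, ← hc, hp]
  obtain ⟨t, ht⟩ := isSquare_of_forall_isSquare_adicCompletion (d := nrd _ _ x) fun v => by
    obtain ⟨c, hc⟩ := hloc v
    have hc0 : c ≠ 0 := by
      rintro rfl
      simp at hc
    refine ⟨c⁻¹, ?_⟩
    field_simp
    linear_combination hc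
  -- The relation `c ^ 2 * nrd x = 1` at any single finite place suffices; one exists because `𝓞 F`
  -- is not a field.
  have ht0 : t ≠ 0 := by
    rintro rfl
    obtain ⟨P, hP0, hP⟩ := Ring.not_isField_iff_exists_prime.1 (RingOfIntegers.not_isField F)
    obtain ⟨c, hc⟩ := hloc ⟨P, hP, hP0⟩
    simp [ht] at hc
  have hn : nrd _ _ (t⁻¹ • x) = 1 := by
    rw [nrd_smul, ht]
    field_simp
  let u : (DAlg a b)ˣ :=
    ⟨t⁻¹ • x, star (t⁻¹ • x), (mul_star_eq_one hn).1, (mul_star_eq_one hn).2⟩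
  have hu : (u : DAlg a b) = t⁻¹ • x := rfl
  have huα : (u⁻¹ * γ)⁻¹ * α = α * (u⁻¹ * γ)⁻¹ := by
    refine Units.ext ?_
    rw [mul_inv_rev, inv_inv]
    simp only [Units.val_mul, hu, mul_smul_comm, smul_mul_assoc]
    rw [hxα]
  refine ⟨u, ?_, u⁻¹ * γ, ?_, by group, hn⟩
  · rw [Subgroup.mem_centralizer_singleton_iff]
    refine Units.ext ?_
    simp only [Units.val_mul, hu, mul_smul_comm, smul_mul_assoc]
    rw [hxβ]
  · rw [← Subgroup.inv_mem_iff, Subgroup.mem_centralizer_singleton_iff]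
    exact huα

/-- A central element maps to a scalar matrix, which has a single eigenvalue. -/
theorem ne_coe_re_of_hasTwoRealEigenvalues {F : Type*} [Field F] {a b : 𝓞 F} {σ : F →+* ℝ}
    {τ : DReal a b σ ≃ₐ[ℝ] Matrix (Fin 2) (Fin 2) ℝ} {β : (DAlg a b)ˣ}
    (h : HasTwoRealEigenvalues (toGL τ β : Matrix (Fin 2) (Fin 2) ℝ)) :
    (β : DAlg a b) ≠ ((β : DAlg a b).re : DAlg a b) := by
  intro hβ
  obtain ⟨s, t, hst, hs, ht⟩ := h
  have hM : (toGL τ β : Matrix (Fin 2) (Fin 2) ℝ) =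
      (σ (β : DAlg a b).re) • (1 : Matrix (Fin 2) (Fin 2) ℝ) := by
    change τ (Quat.map σ _ _ (β : DAlg a b)) = _
    have : Quat.map σ _ _ (β : DAlg a b) = (σ (β : DAlg a b).re) • (1 : DReal a b σ) := by
      conv_lhs => rw [hβ]
      ext <;> simp [Quat.map]
    rw [this, map_smul, map_one]
  have key (e : ℝ) (he : Module.End.HasEigenvalue
      (Matrix.toLin' (toGL τ β : Matrix (Fin 2) (Fin 2) ℝ)) e) : e = σ (β : DAlg a b).re := by
    obtain ⟨w, hw⟩ := he.exists_hasEigenvector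
    have h1 := hw.apply_eq_smul
    rw [hM, map_smul, Matrix.toLin'_one, LinearMap.smul_apply, LinearMap.id_apply] at h1
    exact (smul_left_injective ℝ hw.2 h1).symm
  exact hst ((key s hs).trans (key t ht).symm)

end Main

end QuatProd

theorem mainTheorem4
    {F : Type*} [Field F] [NumberField F] [NumberField.IsTotallyReal F]
    (a b : NumberField.RingOfIntegers F) (ha : a ≠ 0) (hb : b ≠ 0)
    {r : ℕ} [NeZero r]
    -- the real embeddings at which `D = (a, b)_F` is split
    (σ : Fin r → F →+* ℝ) (hσ_inj : Function.Injective σ)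
    (hσ : ∀ s : F →+* ℝ, s ∈ Set.range σ ↔ QuatProd.IsSplitAt a b s)
    (hσa : ∀ k, 0 < σ k (algebraMap (NumberField.RingOfIntegers F) F a))
    (τ : ∀ k, QuatProd.DReal a b (σ k) ≃ₐ[ℝ] Matrix (Fin 2) (Fin 2) ℝ)
    (hτ : ∀ q : QuatProd.DReal a b (σ 0),
      τ 0 q =
        !![q.re + q.imI * √(σ 0 (algebraMap (NumberField.RingOfIntegers F) F a)),
            q.imJ + q.imK * √(σ 0 (algebraMap (NumberField.RingOfIntegers F) F a));
          σ 0 (algebraMap (NumberField.RingOfIntegers F) F b) *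
              (q.imJ - q.imK * √(σ 0 (algebraMap (NumberField.RingOfIntegers F) F a))),
            q.re - q.imI * √(σ 0 (algebraMap (NumberField.RingOfIntegers F) F a))])
    (α β : (QuatProd.DAlg a b)ˣ) (hα : α ∈ QuatProd.SL _ _)
    (hα_eig : ∀ k, QuatProd.HasTwoRealEigenvalues
      (QuatProd.toGL (τ k) α : Matrix (Fin 2) (Fin 2) ℝ))
    (hβ_eig : ∀ k, QuatProd.HasTwoRealEigenvalues
      (QuatProd.toGL (τ k) β : Matrix (Fin 2) (Fin 2) ℝ))
    -- the field in question is `F(√a)`, with `F` embedded in `ℝ` by `σ 0`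
    (hβ_diag : QuatProd.IsDiagonalizableOver
      (Subfield.closure (Set.range (σ 0) ∪
        {√(σ 0 (algebraMap (NumberField.RingOfIntegers F) F a))}))
      (QuatProd.toGL (τ 0) β : Matrix (Fin 2) (Fin 2) ℝ))
    (γ : QuatProd.SL a b)
    (hγ : QuatProd.toHat a b γ ∈
      closure[QuatProd.SL.topology _ _] (QuatProd.toHat a b ''
        {g | ∃ u ∈ QuatProd.centralizerInLambda a b β,
          ∃ v ∈ QuatProd.centralizerInLambda a b α, g = u * v})) :
    ∃ x ∈ Subgroup.centralizer {β}, ∃ y ∈ Subgroup.centralizer {α},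
      QuatProd.toD a b γ = x * y ∧
      QuatProd.IsOrientationPreservingIsometry (QuatProd.act τ x) ∧
      ∀ k, 0 < (QuatProd.toGL (τ k) x : Matrix (Fin 2) (Fin 2) ℝ).det := by
  have hβ := QuatProd.ne_coe_re_of_hasTwoRealEigenvalues (hβ_eig 0)
  obtain ⟨x, hx, y, hy, hxy, hn⟩ := QuatProd.exists_global_factorization ha hb hβ
    (QuatProd.exists_local_factorization hγ)
  have hdet (k) : 0 < (QuatProd.toGL (τ k) x : Matrix (Fin 2) (Fin 2) ℝ).det := by
    refine QuatProd.det_pos_of_nrd_pos (τ k) (q := QuatProd.Quat.map (σ k) _ _ (x : _)) ?_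
    rw [QuatProd.nrd_map, hn, map_one]
    exact one_pos
  exact ⟨x, hx, y, hy, hxy, QuatProd.isOrientationPreservingIsometry_smul hdet, hdet⟩
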